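/- Let $k\ge 2$ and $1\le i\le k$ be integers, and let $q\in\mathbb{C}$ with $|q|<1$. Fix a square root $q^{1/2}$ of $q$ and write $q^{m/2}=(q^{1/2})^m$ for integers $m\ge 0$. Put $(a;p)_n=\prod_{j=0}^{n-1}(1-ap^j)$ and, for $|p|<1$, $(a;p)_\infty=\prod_{j\ge 0}(1-ap^j)$ and $(a_1,a_2,a_3;p)_\infty=(a_1;p)_\infty(a_2;p)_\infty(a_3;p)_\infty$. For integers $n_1,\dots,n_k\ge 0$ let $N_l=n_l+n_{l+1}+\cdots+n_k$ for $1\le l\le k$, and $N_l=0$ for $l>k$. Then the following series converges absolutely, and $$\sum_{n_1,\dots,n_k\ge 0}\frac{q^{\frac12(N_1^2+\cdots+N_k^2)+N_i+N_{i+2}+N_{i+4}+\cdots}}{(q;q)_{n_1}\cdots(q;q)_{n_{k-1}}(q^2;q^2)_{n_k}}=\frac{(-q^{1/2};q)_\infty\,\bigl(q^{i/2},\,q^{(2k-i+3)/2},\,q^{(2k+3)/2};\,q^{(2k+3)/2}\bigr)_\infty}{(q;q)_\infty}.$$ -/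

import Mathlib

namespace Warnaar

open Finset

/-- The finite `q`-shifted factorial `(a;q)_n = ∏_{j=0}^{n-1} (1 - a q^j)`. -/
noncomputable def qPoch (a q : ℂ) (n : ℕ) : ℂ :=
  ∏ j ∈ range n, (1 - a * q ^ j)

/-- The infinite `q`-shifted factorial `(a;q)_∞ = ∏_{j≥0} (1 - a q^j)`, meant for `|q| < 1`. -/
noncomputable def qPochInf (a q : ℂ) : ℂ :=
  ∏' j : ℕ, (1 - a * q ^ j)

/-- For `|q| < 1` the product that defines `(a;q)_∞` converges, whatever `a` is. -/
theorem multipliable_qPochInf (a q : ℂ) (hq : ‖q‖ < 1) :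
    Multipliable fun j : ℕ => 1 - a * q ^ j := by
  have h : Summable fun j : ℕ => ‖-(a * q ^ j)‖ := by
    simp only [norm_neg, norm_mul, norm_pow]
    exact (summable_geometric_of_lt_one (norm_nonneg q) hq).mul_left _
  simpa [sub_eq_add_neg] using multipliable_one_add_of_summable h

/-- `N_l = n_l + n_{l+1} + ⋯ + n_k`, where the tuple `(n_1, …, n_k)` is given as a function on
`Fin k`, the entry `n_j` being its value at the index `j - 1`. In particular `N_l = 0` for
`l > k`. -/
def tailSum {k : ℕ} (n : Fin k → ℕ) (l : ℕ) : ℕ :=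
  ∑ j : Fin k with l ≤ j.val + 1, n j

/-- The sum `N_1^2 + ⋯ + N_k^2`. -/
def sqSum {k : ℕ} (n : Fin k → ℕ) : ℕ :=
  ∑ l ∈ Icc 1 k, tailSum n l ^ 2

/-- The sum `N_i + N_{i+2} + N_{i+4} + ⋯`, over the indices `i ≤ l ≤ k` of the parity of `i`. -/
def altSum {k : ℕ} (i : ℕ) (n : Fin k → ℕ) : ℕ :=
  ∑ l ∈ Icc i k with l % 2 = i % 2, tailSum n l

/-- The denominator `(q;q)_{n_1} ⋯ (q;q)_{n_{k-1}} (q^2;q^2)_{n_k}`. -/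
noncomputable def denom {k : ℕ} (q : ℂ) (n : Fin k → ℕ) : ℂ :=
  ∏ j : Fin k, if j.val + 1 = k then qPoch (q ^ 2) (q ^ 2) (n j) else qPoch q q (n j)

end Warnaar

/-!
Put `q = s ^ 2`. By the `q`-Chu-Vandermonde sum, each kernel
`n ↦ (-s;q)_n / ((q;q)_{n-r} (q;q)_{n+r})` is an eigenvector of the weighted Bailey transform
`f ↦ (L ↦ ∑_n s ^ (n ^ 2) f n / (q;q)_{L-n})`, with eigenvalue `s ^ (r ^ 2)`. The seed
`1 / (q^2;q^2)_n` is the combination of these kernels whose coefficients are the terms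
`x ^ (r (r + 1) / 2) * y ^ (r (r - 1) / 2)` of a theta series, with `(x, y) = (-s ^ 2, -s)`. Hence a
step of the Bailey chain only replaces `(x, y)` by `(x * s, y * s)`. A step with the additional
factor `q ^ n` also stays within this family: the symmetry `r ↦ -1 - r` of the theta terms absorbs
that factor into the parameters. Letting `L → ∞` turns the chain into the multiple series on one
side and into a theta series on the other, which the Jacobi triple product identity evaluates.
-/

namespace Warnaar

open Finset Filter Topology

/-! ### Shifted factorials -/

theorem qPoch_zero (a q : ℂ) : qPoch a q 0 = 1 := by simp [qPoch]

theorem qPoch_succ (a q : ℂ) (n : ℕ) : qPoch a q (n + 1) = qPoch a q n * (1 - a * q ^ n) :=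
  prod_range_succ _ n

theorem qPoch_add (a q : ℂ) (m n : ℕ) :
    qPoch a q (m + n) = qPoch a q m * qPoch (a * q ^ m) q n := by
  simp only [qPoch, prod_range_add, pow_add, mul_assoc]

theorem qPoch_succ' (a q : ℂ) (n : ℕ) : qPoch a q (n + 1) = (1 - a) * qPoch (a * q) q n := by
  rw [add_comm, qPoch_add]
  simp [qPoch]

theorem qPochInf_zero (q : ℂ) : qPochInf 0 q = 1 := by simp [qPochInf]

theorem not_isOfFinOrder_of_norm_lt_one {q : ℂ} (hq : ‖q‖ < 1) : ¬IsOfFinOrder q :=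
  fun h => hq.ne h.norm_eq_one

theorem one_sub_pow_succ_ne_zero {q : ℂ} (hq : ¬IsOfFinOrder q) (n : ℕ) : 1 - q ^ (n + 1) ≠ 0 :=
  fun h => hq (isOfFinOrder_iff_pow_eq_one.2 ⟨n + 1, n.succ_pos, (sub_eq_zero.1 h).symm⟩)

theorem qPoch_self_ne_zero {q : ℂ} (hq : ¬IsOfFinOrder q) (n : ℕ) : qPoch q q n ≠ 0 :=
  prod_ne_zero_iff.2 fun j _ => by
    rw [← pow_succ']
    exact one_sub_pow_succ_ne_zero hq j

/-- The reciprocal `1 / (q;q)_m` of the `q`-factorial of an integer `m`. As usual in the theory of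
basic hypergeometric series it is `0` for `m < 0`, which makes `one_sub_zpow_mul_invQFac` hold for
all integers. -/
noncomputable def invQFac (q : ℂ) : ℤ → ℂ
  | Int.ofNat n => (qPoch q q n)⁻¹
  | Int.negSucc _ => 0

theorem invQFac_natCast (q : ℂ) (n : ℕ) : invQFac q n = (qPoch q q n)⁻¹ := rfl

theorem invQFac_zero (q : ℂ) : invQFac q 0 = 1 :=
  (invQFac_natCast q 0).trans (by rw [qPoch_zero, inv_one])

theorem invQFac_of_neg (q : ℂ) {m : ℤ} (hm : m < 0) : invQFac q m = 0 := by
  obtain ⟨n, rfl⟩ := Int.eq_negSucc_of_lt_zero hm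
  rfl

theorem one_sub_pow_mul_invQFac_succ {q : ℂ} (hq : ¬IsOfFinOrder q) (n : ℕ) :
    (1 - q ^ (n + 1)) * invQFac q (n + 1 : ℕ) = invQFac q n := by
  have := one_sub_pow_succ_ne_zero hq n
  rw [invQFac_natCast, invQFac_natCast, qPoch_succ, ← pow_succ']
  field_simp

theorem one_sub_zpow_mul_invQFac {q : ℂ} (hq : ¬IsOfFinOrder q) (m : ℤ) :
    (1 - q ^ m) * invQFac q m = invQFac q (m - 1) := by
  rcases lt_trichotomy m 0 with hm | rfl | hm
  · rw [invQFac_of_neg q hm, invQFac_of_neg q (by omega), mul_zero]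
  · rw [zpow_zero, sub_self, zero_mul, invQFac_of_neg q (by omega)]
  · obtain ⟨n, rfl⟩ : ∃ n : ℕ, m = (n + 1 : ℕ) := ⟨(m - 1).toNat, by omega⟩
    rw [zpow_natCast, one_sub_pow_mul_invQFac_succ hq]
    simp

theorem invQFac_add_mul_qPoch {q : ℂ} (hq : ¬IsOfFinOrder q) (m n : ℕ) :
    invQFac q (m + n : ℕ) * qPoch (q * q ^ m) q n = invQFac q m := by
  have hne := qPoch_self_ne_zero hq (m + n)
  rw [qPoch_add] at hne
  have := left_ne_zero_of_mul hne
  have := right_ne_zero_of_mul hne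
  rw [invQFac_natCast, invQFac_natCast, qPoch_add]
  field_simp

/-! ### The `q`-Chu-Vandermonde sum -/

theorem choose_two_succ (n : ℕ) : (n + 1).choose 2 = n + n.choose 2 := by
  rw [Nat.choose_succ_succ' n 1, Nat.choose_one_right]

theorem add_two_mul_choose_two (n : ℕ) : n + 2 * n.choose 2 = n ^ 2 := by
  induction n with
  | zero => rfl
  | succ n ih => rw [choose_two_succ, add_sq, ← ih]; ring

theorem sum_invQFac_pascal {q : ℂ} (hq : ¬IsOfFinOrder q) (N : ℕ) (f : ℕ → ℕ → ℂ) :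
    (1 - q ^ (N + 1)) *
        ∑ p ∈ antidiagonal (N + 1), invQFac q p.1 * invQFac q p.2 * f p.1 p.2 =
      ∑ p ∈ antidiagonal N,
        invQFac q p.1 * invQFac q p.2 * (f p.1 (p.2 + 1) + q ^ p.2 * f (p.1 + 1) p.2) := by
  have split : (1 - q ^ (N + 1)) *
        ∑ p ∈ antidiagonal (N + 1), invQFac q p.1 * invQFac q p.2 * f p.1 p.2 =
      ∑ p ∈ antidiagonal (N + 1),
        invQFac q p.1 * ((1 - q ^ p.2) * invQFac q p.2) * f p.1 p.2 +
      ∑ p ∈ antidiagonal (N + 1),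
        ((1 - q ^ p.1) * invQFac q p.1) * invQFac q p.2 * (q ^ p.2 * f p.1 p.2) := by
    rw [mul_sum, ← sum_add_distrib]
    refine sum_congr rfl fun p hp => ?_
    rw [← HasAntidiagonal.mem_antidiagonal.1 hp]
    ring
  rw [split, Finset.Nat.sum_antidiagonal_succ', Finset.Nat.sum_antidiagonal_succ]
  simp only [pow_zero, sub_self, zero_mul, mul_zero, zero_add, one_sub_pow_mul_invQFac_succ hq]
  rw [← sum_add_distrib]
  exact sum_congr rfl fun p _ => by ring

theorem sum_chu_vandermonde {q : ℂ} (hq : ¬IsOfFinOrder q) (M : ℕ) (b w : ℂ) :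
    ∑ p ∈ antidiagonal M, invQFac q p.1 * invQFac q p.2 *
      (qPoch b q p.1 * (-w) ^ p.1 * q ^ p.1.choose 2 * qPoch (b * w * q ^ p.1) q p.2) =
      invQFac q M * qPoch w q M := by
  induction M generalizing b with
  | zero => simp [invQFac_zero, qPoch_zero]
  | succ M ih =>
    apply mul_left_cancel₀ (one_sub_pow_succ_ne_zero hq M)
    rw [sum_invQFac_pascal hq M fun a c => qPoch b q a * (-w) ^ a * q ^ a.choose 2 *
      qPoch (b * w * q ^ a) q c, ← mul_assoc, one_sub_pow_mul_invQFac_succ hq, qPoch_succ]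
    calc
      _ = (1 - b * w * q ^ M) * (invQFac q M * qPoch w q M) +
          (-w * q ^ M * (1 - b)) * (invQFac q M * qPoch w q M) := by
        nth_rw 1 [← ih b]
        rw [← ih (b * q), mul_sum, mul_sum, ← sum_add_distrib]
        refine sum_congr rfl fun p hp => ?_
        rw [← HasAntidiagonal.mem_antidiagonal.1 hp, qPoch_succ, qPoch_succ', choose_two_succ,
          show b * w * q ^ (p.1 + 1) = b * q * w * q ^ p.1 by ring]
        ring
      _ = _ := by ring

/-! ### Theta series and their finite analogues -/

/-- The triangular number `r (r + 1) / 2` of an integer `r`. -/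
def triangular (r : ℤ) : ℤ := r * (r + 1) / 2

theorem two_mul_triangular (r : ℤ) : 2 * triangular r = r * (r + 1) :=
  Int.mul_ediv_cancel' (Int.even_mul_succ_self r).two_dvd

theorem triangular_sub_one (r : ℤ) : triangular (r - 1) = triangular r - r := by
  linarith [two_mul_triangular r, two_mul_triangular (r - 1)]

theorem triangular_neg (r : ℤ) : triangular (-r) = triangular (r - 1) := by
  linarith [two_mul_triangular (-r), two_mul_triangular (r - 1)]

/-- The general term `x ^ (r (r + 1) / 2) * y ^ (r (r - 1) / 2)` of Ramanujan's theta series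
`f(x, y)`. -/
noncomputable def thetaTerm (x y : ℂ) (r : ℤ) : ℂ := x ^ triangular r * y ^ triangular (r - 1)

section thetaTerm

variable {x y z : ℂ}

theorem thetaTerm_zero (x y : ℂ) : thetaTerm x y 0 = 1 := by simp [thetaTerm, triangular]

theorem thetaTerm_neg (x y : ℂ) (r : ℤ) : thetaTerm x y (-r) = thetaTerm y x r := by
  rw [thetaTerm, thetaTerm, triangular_neg, ← neg_add', triangular_neg, add_sub_cancel_right,
    mul_comm]

theorem thetaTerm_ne_zero (hx : x ≠ 0) (hy : y ≠ 0) (r : ℤ) : thetaTerm x y r ≠ 0 :=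
  mul_ne_zero (zpow_ne_zero _ hx) (zpow_ne_zero _ hy)

theorem thetaTerm_div_mul (hz : z ≠ 0) (x y : ℂ) (r : ℤ) :
    thetaTerm (x / z) (y * z) r = z ^ (-r) * thetaTerm x y r := by
  rw [thetaTerm, thetaTerm, div_zpow, mul_zpow, triangular_sub_one, zpow_sub₀ hz, zpow_neg]
  field_simp

theorem thetaTerm_mul_mul (hz : z ≠ 0) (x y : ℂ) (r : ℤ) :
    thetaTerm (x * z) (y * z) r = z ^ (r ^ 2) * thetaTerm x y r := by
  have hr : r ^ 2 = triangular r + triangular (r - 1) := by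
    linarith [two_mul_triangular r, triangular_sub_one r]
  rw [thetaTerm, thetaTerm, mul_zpow, mul_zpow, hr, zpow_add₀ hz]
  ring

theorem thetaTerm_add_one (hx : x ≠ 0) (hy : y ≠ 0) (r : ℤ) :
    thetaTerm x y (r + 1) = x * (x * y) ^ r * thetaTerm x y r := by
  have hr : triangular (r + 1) = triangular r + r + 1 := by
    linarith [triangular_sub_one (r + 1), congrArg triangular (add_sub_cancel_right r 1)]
  have hr' : triangular r = triangular (r - 1) + r := by linarith [triangular_sub_one r]
  rw [thetaTerm, thetaTerm, add_sub_cancel_right, hr, zpow_add_one₀ hx, zpow_add₀ hx, mul_zpow]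
  nth_rw 2 [hr']
  rw [zpow_add₀ hy]
  ring

theorem thetaTerm_neg_one_sub (hy : y ≠ 0) (x : ℂ) (r : ℤ) :
    thetaTerm x y (-1 - r) = y * thetaTerm (x * y ^ 2) y⁻¹ r := by
  have hr : triangular (-1 - r) = triangular r := by
    linarith [two_mul_triangular (-1 - r), two_mul_triangular r]
  have hr' : triangular (-1 - r - 1) = 1 + 2 * triangular r - triangular (r - 1) := by
    linarith [two_mul_triangular (-1 - r - 1), two_mul_triangular r, two_mul_triangular (r - 1)]
  rw [thetaTerm, thetaTerm, hr, hr', mul_zpow, inv_zpow', zpow_sub₀ hy, zpow_add₀ hy, zpow_one,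
    zpow_mul, zpow_ofNat, zpow_neg]
  ring

end thetaTerm

/-- The coefficient `1 / ((q;q)_{a-r} (q;q)_{b+r})`, which vanishes unless `-b ≤ r ≤ a`. -/
noncomputable def invQFacPair (q : ℂ) (a b r : ℤ) : ℂ := invQFac q (a - r) * invQFac q (b + r)

theorem invQFacPair_neg (q : ℂ) (a b r : ℤ) : invQFacPair q a b (-r) = invQFacPair q b a r := by
  rw [invQFacPair, invQFacPair, sub_neg_eq_add, ← sub_eq_add_neg, mul_comm]

theorem invQFacPair_neg_one_sub (q : ℂ) (a b r : ℤ) :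
    invQFacPair q a b (-1 - r) = invQFacPair q (b - 1) (a + 1) r := by
  rw [invQFacPair, invQFacPair, mul_comm]
  congr 2 <;> ring

theorem invQFacPair_of_lt (q : ℂ) {a r : ℤ} (b : ℤ) (h : a < r) : invQFacPair q a b r = 0 := by
  rw [invQFacPair, invQFac_of_neg q (by omega), zero_mul]

theorem invQFacPair_of_lt_neg (q : ℂ) (a : ℤ) {b r : ℤ} (h : r < -b) : invQFacPair q a b r = 0 := by
  rw [invQFacPair, invQFac_of_neg q (m := b + r) (by omega), mul_zero]

theorem summable_mul_invQFacPair (q : ℂ) (a b : ℤ) (c : ℤ → ℂ) :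
    Summable fun r => c r * invQFacPair q a b r := by
  refine summable_of_ne_finset_zero (s := Icc (-b) a) fun r hr => ?_
  rw [mem_Icc, not_and_or, not_le, not_le] at hr
  rcases hr with hr | hr
  · rw [invQFacPair_of_lt_neg q a hr, mul_zero]
  · rw [invQFacPair_of_lt q b hr, mul_zero]

/-- The finite theta sum `∑_r x ^ (r (r + 1) / 2) y ^ (r (r - 1) / 2) / ((q;q)_{a-r} (q;q)_{b+r})`.
Only the terms with `-b ≤ r ≤ a` are nonzero; writing it as a sum over all integers makes it easy
to reindex. -/
noncomputable def thetaSum (q x y : ℂ) (a b : ℤ) : ℂ := ∑' r, thetaTerm x y r * invQFacPair q a b r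

section thetaSum

variable {q x y : ℂ}

theorem thetaSum_comm (q x y : ℂ) (a b : ℤ) : thetaSum q x y a b = thetaSum q y x b a := by
  rw [thetaSum, ← (Equiv.neg ℤ).tsum_eq]
  simp only [Equiv.neg_apply, thetaTerm_neg, invQFacPair_neg, thetaSum]

theorem thetaSum_zero_zero (q x y : ℂ) : thetaSum q x y 0 0 = 1 := by
  rw [thetaSum, tsum_eq_single 0 fun r hr => ?_]
  · simp [thetaTerm_zero, invQFacPair, invQFac_zero]
  · rcases hr.lt_or_gt with hr | hr
    · rw [invQFacPair_of_lt_neg q 0 (by omega), mul_zero]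
    · rw [invQFacPair_of_lt q 0 hr, mul_zero]

theorem thetaSum_reflect (hy : y ≠ 0) (q x : ℂ) (a b : ℤ) :
    thetaSum q x y a b = y * thetaSum q (x * y ^ 2) y⁻¹ (b - 1) (a + 1) := by
  rw [thetaSum, ← (Equiv.subLeft (-1 : ℤ)).tsum_eq]
  simp only [Equiv.subLeft_apply, thetaTerm_neg_one_sub hy, invQFacPair_neg_one_sub, mul_assoc,
    tsum_mul_left, thetaSum]

theorem thetaSum_sub_one_left (hq : ¬IsOfFinOrder q) (hq0 : q ≠ 0) (x y : ℂ) (a b : ℤ) :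
    thetaSum q x y (a - 1) b = thetaSum q x y a b - q ^ a * thetaSum q (x / q) (y * q) a b := by
  simp only [thetaSum]
  rw [← tsum_mul_left, ← (summable_mul_invQFacPair q a b _).tsum_sub
    ((summable_mul_invQFacPair q a b _).mul_left _)]
  refine tsum_congr fun r => ?_
  have hstep := one_sub_zpow_mul_invQFac hq (a - r)
  rw [sub_right_comm] at hstep
  rw [thetaTerm_div_mul hq0, invQFacPair, invQFacPair, ← hstep, zpow_sub₀ hq0, zpow_neg]
  ring

theorem thetaSum_sub_one_right (hq : ¬IsOfFinOrder q) (hq0 : q ≠ 0) (x y : ℂ) (a b : ℤ) :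
    thetaSum q x y a (b - 1) = thetaSum q x y a b - q ^ b * thetaSum q (x * q) (y / q) a b := by
  rw [thetaSum_comm, thetaSum_sub_one_left hq hq0, thetaSum_comm q y, thetaSum_comm q (y / q)]

theorem thetaSum_mul_add_one_left (hq : ¬IsOfFinOrder (x * y)) (hx : x ≠ 0) (hy : y ≠ 0)
    (a b : ℤ) :
    (1 - (x * y) ^ (a + 1 + b)) * thetaSum (x * y) x y (a + 1) b =
      (1 + x * (x * y) ^ a) * thetaSum (x * y) x y a b := by
  have hq0 := mul_ne_zero hx hy
  have left := thetaSum_sub_one_left hq hq0 x y (a + 1) b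
  have right := thetaSum_sub_one_right hq hq0 (x / (x * y)) (y * (x * y)) (a + 1) b
  have reflect := thetaSum_reflect hy (x * y) x a b
  rw [add_sub_cancel_right] at left
  rw [div_mul_cancel₀ x hq0, mul_div_cancel_right₀ y hq0, thetaSum_comm,
    show y * (x * y) = x * y ^ 2 by ring, show x / (x * y) = y⁻¹ by field_simp] at right
  rw [show y * (x * y) = x * y ^ 2 by ring, show x / (x * y) = y⁻¹ by field_simp,
    zpow_add_one₀ hq0] at left
  rw [zpow_add₀ hq0, zpow_add_one₀ hq0]
  linear_combination -left - (x * y) ^ a * x * reflect - (x * y) ^ a * (x * y) * right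

theorem thetaSum_mul_natCast_add_one_left (hq : ¬IsOfFinOrder (x * y)) (hx : x ≠ 0) (hy : y ≠ 0)
    (m n : ℕ) (h : thetaSum (x * y) x y m n =
      invQFac (x * y) (m + n : ℕ) * (qPoch (-x) (x * y) m * qPoch (-y) (x * y) n)) :
    thetaSum (x * y) x y (m + 1 : ℕ) n =
      invQFac (x * y) (m + 1 + n : ℕ) * (qPoch (-x) (x * y) (m + 1) * qPoch (-y) (x * y) n) := by
  apply mul_left_cancel₀ (one_sub_pow_succ_ne_zero hq (m + n))
  have step := thetaSum_mul_add_one_left hq hx hy m n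
  rw [h, zpow_natCast, show (m + 1 + n : ℤ) = (m + n + 1 : ℕ) by push_cast; ring,
    zpow_natCast] at step
  rw [Nat.cast_succ, step, Nat.add_right_comm m 1 n, qPoch_succ,
    ← one_sub_pow_mul_invQFac_succ hq (m + n)]
  ring

/-- A finite form of the Jacobi triple product identity. -/
theorem thetaSum_mul_natCast (hq : ¬IsOfFinOrder (x * y)) (hx : x ≠ 0) (hy : y ≠ 0) (m n : ℕ) :
    thetaSum (x * y) x y m n =
      invQFac (x * y) (m + n : ℕ) * (qPoch (-x) (x * y) m * qPoch (-y) (x * y) n) := by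
  induction m with
  | zero =>
    induction n with
    | zero => simp [thetaSum_zero_zero, invQFac_zero, qPoch_zero]
    | succ n ih =>
      rw [thetaSum_comm, mul_comm x y, add_comm 0, mul_comm (qPoch _ _ 0)] at ih ⊢
      rw [mul_comm x y] at hq
      exact thetaSum_mul_natCast_add_one_left hq hy hx n 0 ih
  | succ m ih => exact thetaSum_mul_natCast_add_one_left hq hx hy m n ih

theorem thetaSum_mul_neg_one (hq : ¬IsOfFinOrder q) (hq0 : q ≠ 0) (x : ℂ) (n : ℤ) :
    thetaSum q (x * q) (-1) n n = q ^ n * thetaSum q x (-q) n n := by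
  have reflect := thetaSum_reflect (neg_ne_zero.2 one_ne_zero) q (x * q) (n - 1) n
  have left := thetaSum_sub_one_left hq hq0 (x * q) (-1) n n
  rw [inv_neg, inv_one, neg_one_sq, mul_one, sub_add_cancel] at reflect
  rw [mul_div_cancel_right₀ x hq0, neg_one_mul] at left
  linear_combination reflect / 2 - left

theorem thetaSum_neg_self_add_one_right (hq : ¬IsOfFinOrder q) (hq0 : q ≠ 0) (y : ℂ) (n : ℤ) :
    thetaSum q (-q) y n (n + 1) =
      (1 - (q ^ (n + 1)) ^ 2) * thetaSum q (-q) y (n + 1) (n + 1) := by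
  have left := thetaSum_sub_one_left hq hq0 (-q) y (n + 1) (n + 1)
  rw [add_sub_cancel_right, neg_div, div_self hq0, thetaSum_comm q (-1),
    thetaSum_mul_neg_one hq hq0, thetaSum_comm q y] at left
  linear_combination left

theorem thetaSum_sq_self (hq : ¬IsOfFinOrder (y ^ 2)) (hy : y ≠ 0) (x : ℂ) (n : ℤ) :
    thetaSum (y ^ 2) x y n n = (1 - y ^ (2 * n + 1)) * thetaSum (y ^ 2) x y n (n + 1) := by
  have right := thetaSum_sub_one_right hq (pow_ne_zero 2 hy) x y n (n + 1)
  have reflect := thetaSum_reflect hy (y ^ 2) x n (n + 1)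
  rw [add_sub_cancel_right] at right reflect
  have hpow : (y ^ 2) ^ (n + 1) = y ^ (2 * n + 1) * y := by
    rw [← zpow_add_one₀ hy, ← zpow_natCast y 2, ← zpow_mul]
    congr 1
    push_cast
    ring
  rw [show y / y ^ 2 = y⁻¹ by field_simp, hpow] at right
  linear_combination right + y ^ (2 * n + 1) * reflect

theorem inv_qPoch_eq_thetaSum {s : ℂ} (hs : ¬IsOfFinOrder s) (hs0 : s ≠ 0) (n : ℕ) :
    (qPoch (s ^ 4) (s ^ 4) n)⁻¹ =
      qPoch (-s) (s ^ 2) n * thetaSum (s ^ 2) (-s ^ 2) (-s) n n := by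
  have hs2 : ¬IsOfFinOrder (s ^ 2) := by simpa using hs
  induction n with
  | zero => simp [qPoch_zero, thetaSum_zero_zero]
  | succ n ih =>
    have hsq := thetaSum_sq_self (y := -s) (by rwa [neg_sq]) (neg_ne_zero.2 hs0) (-s ^ 2) n
    have hright := thetaSum_neg_self_add_one_right hs2 (pow_ne_zero 2 hs0) (-s) n
    have hodd : (-s) ^ (2 * n + 1 : ℤ) = -s * (s ^ 2) ^ n := by
      rw [show (2 * n + 1 : ℤ) = (2 * n + 1 : ℕ) by push_cast; ring, zpow_natCast, pow_succ',
        pow_mul, neg_sq]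
    have heven : ((s ^ 2) ^ (n + 1 : ℤ)) ^ 2 = s ^ 4 * (s ^ 4) ^ n := by
      rw [← Nat.cast_add_one, zpow_natCast]
      ring
    have hne : 1 - s ^ 4 * (s ^ 4) ^ n ≠ 0 := by
      rw [← pow_succ']
      exact one_sub_pow_succ_ne_zero (by simpa using hs) n
    rw [neg_sq, hright, hodd, heven] at hsq
    rw [qPoch_succ, qPoch_succ, mul_inv, ih, hsq, Nat.cast_succ]
    field_simp

end thetaSum

/-! ### The Bailey chain -/

/-- The Bailey transform `f ↦ (L ↦ ∑_{n ≤ L} f n / (q;q)_{L-n})`. -/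
noncomputable def baileyTransform (q : ℂ) (f : ℕ → ℂ) (L : ℕ) : ℂ :=
  ∑ p ∈ antidiagonal L, invQFac q p.1 * f p.2

theorem baileyTransform_eq_sum_range (q : ℂ) (f : ℕ → ℂ) (L : ℕ) :
    baileyTransform q f L = ∑ n ∈ range (L + 1), invQFac q (L - n : ℕ) * f n := by
  rw [baileyTransform, ← Finset.Nat.sum_antidiagonal_swap,
    Finset.Nat.sum_antidiagonal_eq_sum_range_succ_mk]
  rfl

theorem baileyTransform_add {q : ℂ} {f : ℕ → ℂ} {r : ℕ} (hf : ∀ n < r, f n = 0) (M : ℕ) :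
    baileyTransform q f (r + M) = baileyTransform q (fun n => f (r + n)) M := by
  rw [baileyTransform_eq_sum_range, baileyTransform_eq_sum_range, add_assoc, sum_range_add,
    sum_eq_zero fun n hn => by rw [hf n (mem_range.1 hn), mul_zero], zero_add]
  simp only [Nat.add_sub_add_left]

/-- The kernel `(-s;q)_n / ((q;q)_{n-r} (q;q)_{n+r})` with `q = s ^ 2`, an eigenvector of the Bailey
transform weighted by `s ^ (n ^ 2)`. -/
noncomputable def kernel (s : ℂ) (r : ℤ) (n : ℕ) : ℂ :=
  qPoch (-s) (s ^ 2) n * invQFacPair (s ^ 2) n n r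

theorem kernel_neg (s : ℂ) (r : ℤ) (n : ℕ) : kernel s (-r) n = kernel s r n := by
  rw [kernel, invQFacPair_neg, kernel]

theorem kernel_of_lt (s : ℂ) {r n : ℕ} (h : n < r) : kernel s r n = 0 := by
  rw [kernel, invQFacPair_of_lt _ _ (by omega), mul_zero]

theorem kernel_add (s : ℂ) (r n : ℕ) :
    kernel s r (r + n) = qPoch (-s) (s ^ 2) r * qPoch (-s * (s ^ 2) ^ r) (s ^ 2) n *
      (invQFac (s ^ 2) n * invQFac (s ^ 2) (2 * r + n : ℕ)) := by
  rw [kernel, qPoch_add, invQFacPair]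
  congr 3 <;> push_cast <;> ring

theorem invQFac_mul_kernel_add {s : ℂ} (hs : ¬IsOfFinOrder (s ^ 2)) (r m n : ℕ) :
    invQFac (s ^ 2) m * (s ^ ((r + n) ^ 2) * kernel s r (r + n)) =
      s ^ r ^ 2 * qPoch (-s) (s ^ 2) r * invQFac (s ^ 2) (2 * r + (n + m) : ℕ) *
        (invQFac (s ^ 2) n * invQFac (s ^ 2) m *
          (qPoch (-s * (s ^ 2) ^ r) (s ^ 2) n * (-(-s * (s ^ 2) ^ r)) ^ n *
            (s ^ 2) ^ n.choose 2 *
            qPoch (-s * (s ^ 2) ^ r * (-s * (s ^ 2) ^ r) * (s ^ 2) ^ n) (s ^ 2) m)) := by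
  have hbase : -s * (s ^ 2) ^ r * (-s * (s ^ 2) ^ r) * (s ^ 2) ^ n =
      s ^ 2 * (s ^ 2) ^ (2 * r + n) := by ring
  have hpow : s ^ (r + n) ^ 2 = s ^ r ^ 2 * (-(-s * (s ^ 2) ^ r)) ^ n * (s ^ 2) ^ n.choose 2 := by
    rw [show (r + n) ^ 2 = r ^ 2 + 2 * r * n + n ^ 2 by ring, ← add_two_mul_choose_two n]
    ring
  rw [hbase, hpow, kernel_add, ← add_assoc, ← invQFac_add_mul_qPoch hs (2 * r + n) m]
  ring

theorem baileyTransform_kernel_natCast {s : ℂ} (hs : ¬IsOfFinOrder (s ^ 2)) (r L : ℕ) :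
    baileyTransform (s ^ 2) (fun n => s ^ n ^ 2 * kernel s r n) L = s ^ r ^ 2 * kernel s r L := by
  rcases lt_or_ge L r with hLr | hrL
  · rw [kernel_of_lt s hLr, mul_zero, baileyTransform]
    refine sum_eq_zero fun p hp => ?_
    rw [kernel_of_lt s ((HasAntidiagonal.antidiagonal.snd_le hp).trans_lt hLr), mul_zero, mul_zero]
  · obtain ⟨M, rfl⟩ := Nat.exists_eq_add_of_le hrL
    rw [baileyTransform_add fun n hn => by rw [kernel_of_lt s hn, mul_zero], baileyTransform,
      ← Finset.Nat.sum_antidiagonal_swap]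
    calc
      _ = s ^ r ^ 2 * qPoch (-s) (s ^ 2) r * invQFac (s ^ 2) (2 * r + M : ℕ) *
          (invQFac (s ^ 2) M * qPoch (-s * (s ^ 2) ^ r) (s ^ 2) M) := by
        rw [← sum_chu_vandermonde hs M (-s * (s ^ 2) ^ r), mul_sum]
        refine sum_congr rfl fun p hp => ?_
        rw [Prod.fst_swap, Prod.snd_swap, invQFac_mul_kernel_add hs,
          HasAntidiagonal.mem_antidiagonal.1 hp]
      _ = _ := by rw [kernel_add]; ring

theorem baileyTransform_kernel {s : ℂ} (hs : ¬IsOfFinOrder (s ^ 2)) (r : ℤ) (L : ℕ) :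
    baileyTransform (s ^ 2) (fun n => s ^ n ^ 2 * kernel s r n) L = s ^ (r ^ 2) * kernel s r L := by
  obtain ⟨m, rfl | rfl⟩ := r.eq_nat_or_neg
  · exact_mod_cast baileyTransform_kernel_natCast hs m L
  · simp only [kernel_neg, neg_sq]
    exact_mod_cast baileyTransform_kernel_natCast hs m L

theorem qPoch_mul_thetaSum (s x y : ℂ) (n : ℕ) :
    qPoch (-s) (s ^ 2) n * thetaSum (s ^ 2) x y n n = ∑' r, thetaTerm x y r * kernel s r n := by
  rw [thetaSum, ← tsum_mul_left]
  exact tsum_congr fun r => by rw [kernel]; ring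

theorem summable_mul_kernel (s : ℂ) (c : ℤ → ℂ) (n : ℕ) :
    Summable fun r => c r * kernel s r n :=
  ((summable_mul_invQFacPair (s ^ 2) n n c).mul_left (qPoch (-s) (s ^ 2) n)).congr fun r => by
    rw [kernel]; ring

theorem baileyTransform_thetaSum {s : ℂ} (hs : ¬IsOfFinOrder (s ^ 2)) (hs0 : s ≠ 0) (x y : ℂ)
    (L : ℕ) :
    baileyTransform (s ^ 2)
        (fun n => s ^ n ^ 2 * (qPoch (-s) (s ^ 2) n * thetaSum (s ^ 2) x y n n)) L =
      qPoch (-s) (s ^ 2) L * thetaSum (s ^ 2) (x * s) (y * s) L L := by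
  calc
    _ = ∑ p ∈ antidiagonal L, ∑' r,
        thetaTerm x y r * (invQFac (s ^ 2) p.1 * (s ^ p.2 ^ 2 * kernel s r p.2)) := by
      refine sum_congr rfl fun p _ => ?_
      simp only [qPoch_mul_thetaSum, ← tsum_mul_left]
      exact tsum_congr fun r => by ring
    _ = ∑' r, thetaTerm x y r *
        baileyTransform (s ^ 2) (fun n => s ^ n ^ 2 * kernel s r n) L := by
      rw [← Summable.tsum_finsetSum fun p _ => ?_]
      · simp only [baileyTransform, mul_sum]
      · exact ((summable_mul_kernel s (thetaTerm x y) p.2).mul_left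
          (invQFac (s ^ 2) p.1 * s ^ p.2 ^ 2)).congr fun r => by ring
    _ = _ := by
      rw [qPoch_mul_thetaSum]
      refine tsum_congr fun r => ?_
      rw [baileyTransform_kernel hs, thetaTerm_mul_mul hs0]
      ring

/-- The weight `q ^ (N ^ 2 / 2)`, or `q ^ (N ^ 2 / 2 + N)` if `i = 1`, with which `N = N_1` enters
the multiple series; here `q = s ^ 2`. -/
noncomputable def weight (s : ℂ) (i N : ℕ) : ℂ := s ^ (N ^ 2 + if i = 1 then 2 * N else 0)

/-- The index that plays the role of `i` once `N_1` is split off from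
`N_i + N_{i+2} + N_{i+4} + ⋯` and `N_2, N_3, …` are renumbered as `N_1, N_2, …`. -/
def nextIndex (i : ℕ) : ℕ := if i = 1 then 2 else i - 1

/-- The Bailey chain grown from `1 / (q^2;q^2)_n` with `q = s ^ 2`: the multiple series truncated
to `N_1 ≤ n` in `k` summation variables, preceded by the factor `1 / (q;q)_{n - N_1}`. -/
noncomputable def chain (s : ℂ) : ℕ → ℕ → ℕ → ℂ
  | 0, _, n => (qPoch (s ^ 4) (s ^ 4) n)⁻¹
  | k + 1, i, n => baileyTransform (s ^ 2) (fun m => weight s i m * chain s k (nextIndex i) m) n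

theorem chain_eq_thetaSum {s : ℂ} (hs : ¬IsOfFinOrder s) (hs0 : s ≠ 0) (k : ℕ) {i : ℕ}
    (hi : 1 ≤ i) (hik : i ≤ k + 2) (n : ℕ) :
    chain s k i n =
      qPoch (-s) (s ^ 2) n * thetaSum (s ^ 2) (-s ^ (2 * k + 3 - i)) (-s ^ i) n n := by
  have hs2 : ¬IsOfFinOrder (s ^ 2) := by simpa using hs
  induction k generalizing i n with
  | zero =>
    rw [chain, inv_qPoch_eq_thetaSum hs hs0]
    obtain rfl | rfl : i = 1 ∨ i = 2 := by omega
    · rw [pow_one]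
    · rw [thetaSum_comm, pow_one]
  | succ k ih =>
    rw [chain]
    obtain ⟨j, rfl⟩ : ∃ j, i = j + 1 := ⟨i - 1, by omega⟩
    rcases j with _ | j
    · have hstep (m : ℕ) : weight s 1 m * chain s k (nextIndex 1) m = s ^ m ^ 2 *
          (qPoch (-s) (s ^ 2) m * thetaSum (s ^ 2) (-s ^ (2 * k + 1) * s ^ 2) (-1) m m) := by
        rw [thetaSum_mul_neg_one hs2 (pow_ne_zero 2 hs0), nextIndex, if_pos rfl,
          ih one_le_two (by omega), weight, if_pos rfl, pow_add, pow_mul, zpow_natCast,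
          show 2 * k + 3 - 2 = 2 * k + 1 by omega]
        ring
      simp only [zero_add, hstep]
      rw [baileyTransform_thetaSum hs2 hs0, neg_one_mul, pow_one,
        show -s ^ (2 * k + 1) * s ^ 2 * s = -s ^ (2 * (k + 1) + 3 - 1) by
          rw [show 2 * (k + 1) + 3 - 1 = 2 * k + 4 by omega]; ring]
    · have hstep (m : ℕ) : weight s (j + 2) m * chain s k (nextIndex (j + 2)) m = s ^ m ^ 2 *
          (qPoch (-s) (s ^ 2) m * thetaSum (s ^ 2) (-s ^ (2 * k + 2 - j)) (-s ^ (j + 1)) m m) := by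
        rw [nextIndex, if_neg (by omega), show j + 2 - 1 = j + 1 by omega,
          ih (by omega) (by omega), weight, if_neg (by omega), add_zero,
          show 2 * k + 3 - (j + 1) = 2 * k + 2 - j by omega]
      simp only [add_assoc, Nat.reduceAdd, hstep]
      rw [baileyTransform_thetaSum hs2 hs0, neg_mul, neg_mul, ← pow_succ, ← pow_succ,
        show 2 * (k + 1) + 3 - (j + 2) = 2 * k + 2 - j + 1 by omega]

/-! ### Passage to the limit -/

section limits

variable {q x y : ℂ}

theorem tendsto_qPoch (a : ℂ) (hq : ‖q‖ < 1) : Tendsto (qPoch a q) atTop (𝓝 (qPochInf a q)) :=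
  (multipliable_qPochInf a q hq).hasProd.tendsto_prod_nat

theorem qPochInf_self_ne_zero (hq : ‖q‖ < 1) : qPochInf q q ≠ 0 := by
  have hfactor (j : ℕ) : 1 + -(q * q ^ j) ≠ 0 := by
    rw [← sub_eq_add_neg, ← pow_succ']
    exact one_sub_pow_succ_ne_zero (not_isOfFinOrder_of_norm_lt_one hq) j
  have hsum : Summable fun j : ℕ => ‖-(q * q ^ j)‖ := by
    simp only [norm_neg, norm_mul, norm_pow]
    exact (summable_geometric_of_lt_one (norm_nonneg q) hq).mul_left _
  simpa [qPochInf, sub_eq_add_neg] using tprod_one_add_ne_zero_of_summable hfactor hsum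

theorem tendsto_invQFac (hq : ‖q‖ < 1) : Tendsto (invQFac q) atTop (𝓝 (qPochInf q q)⁻¹) := by
  rw [← Nat.map_cast_int_atTop, tendsto_map'_iff]
  exact (tendsto_qPoch q hq).inv₀ (qPochInf_self_ne_zero hq)

theorem exists_norm_invQFac_le (hq : ‖q‖ < 1) : ∃ C, ∀ m, ‖invQFac q m‖ ≤ C := by
  have hnat := (tendsto_invQFac hq).comp tendsto_natCast_atTop_atTop
  obtain ⟨C, hC⟩ := (Metric.isBounded_range_of_tendsto _ hnat).exists_norm_le
  refine ⟨C, fun m => ?_⟩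
  rcases lt_or_ge m 0 with hm | hm
  · rw [invQFac_of_neg q hm, norm_zero]
    exact (norm_nonneg _).trans (hC _ ⟨0, rfl⟩)
  · lift m to ℕ using hm
    exact hC _ ⟨m, rfl⟩

theorem tendsto_invQFacPair (hq : ‖q‖ < 1) (r : ℤ) :
    Tendsto (fun n : ℕ => invQFacPair q n n r) atTop
      (𝓝 ((qPochInf q q)⁻¹ * (qPochInf q q)⁻¹)) :=
  ((tendsto_invQFac hq).comp
      (tendsto_atTop_add_const_right _ (-r) tendsto_natCast_atTop_atTop)).mul
    ((tendsto_invQFac hq).comp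
      (tendsto_atTop_add_const_right _ r tendsto_natCast_atTop_atTop))

theorem summable_thetaTerm_natCast (hx : x ≠ 0) (hy : y ≠ 0) (hxy : ‖x * y‖ < 1) :
    Summable fun n : ℕ => thetaTerm x y n := by
  refine summable_of_ratio_test_tendsto_lt_one zero_lt_one
    (Eventually.of_forall fun n => thetaTerm_ne_zero hx hy n) ?_
  have hratio : Tendsto (fun n : ℕ => ‖x‖ * ‖x * y‖ ^ n) atTop (𝓝 (‖x‖ * 0)) :=
    (tendsto_pow_atTop_nhds_zero_of_lt_one (norm_nonneg _) hxy).const_mul _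
  rw [mul_zero] at hratio
  refine hratio.congr fun n => ?_
  rw [Nat.cast_succ, thetaTerm_add_one hx hy, zpow_natCast, norm_mul (x * _),
    mul_div_cancel_right₀ _ (norm_ne_zero_iff.2 (thetaTerm_ne_zero hx hy n)), norm_mul x (_ ^ n),
    norm_pow]

theorem summable_thetaTerm (hx : x ≠ 0) (hy : y ≠ 0) (hxy : ‖x * y‖ < 1) :
    Summable (thetaTerm x y) := by
  refine (summable_thetaTerm_natCast hx hy hxy).of_nat_of_neg ?_
  simp only [thetaTerm_neg]
  exact summable_thetaTerm_natCast hy hx (by rwa [mul_comm])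

theorem tendsto_thetaSum (hq : ‖q‖ < 1) (hx : x ≠ 0) (hy : y ≠ 0) (hxy : ‖x * y‖ < 1) :
    Tendsto (fun n : ℕ => thetaSum q x y n n) atTop
      (𝓝 ((∑' r, thetaTerm x y r) * ((qPochInf q q)⁻¹ * (qPochInf q q)⁻¹))) := by
  obtain ⟨C, hC⟩ := exists_norm_invQFac_le hq
  rw [← tsum_mul_right]
  refine tendsto_tsum_of_dominated_convergence
    ((summable_thetaTerm hx hy hxy).norm.mul_right (C * C))
    (fun r => (tendsto_invQFacPair hq r).const_mul _) (Eventually.of_forall fun n r => ?_)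
  rw [norm_mul, invQFacPair, norm_mul]
  gcongr
  · exact (norm_nonneg _).trans (hC 0)
  · exact hC _
  · exact hC _

/-- The Jacobi triple product identity. -/
theorem tsum_thetaTerm (hx : x ≠ 0) (hy : y ≠ 0) (hxy : ‖x * y‖ < 1) :
    ∑' r, thetaTerm x y r =
      qPochInf (-x) (x * y) * qPochInf (-y) (x * y) * qPochInf (x * y) (x * y) := by
  have hproduct : Tendsto (fun n : ℕ => thetaSum (x * y) x y n n) atTop
      (𝓝 ((qPochInf (x * y) (x * y))⁻¹ *
        (qPochInf (-x) (x * y) * qPochInf (-y) (x * y)))) := by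
    simp only [thetaSum_mul_natCast (not_isOfFinOrder_of_norm_lt_one hxy) hx hy]
    have hdouble : Tendsto (fun n : ℕ => ((n + n : ℕ) : ℤ)) atTop atTop :=
      tendsto_natCast_atTop_atTop.comp (tendsto_id.atTop_add_atTop tendsto_id)
    exact ((tendsto_invQFac hxy).comp hdouble).mul
      ((tendsto_qPoch _ hxy).mul (tendsto_qPoch _ hxy))
  have hunique := tendsto_nhds_unique (tendsto_thetaSum hxy hx hy hxy) hproduct
  have hne := qPochInf_self_ne_zero hxy
  field_simp at hunique
  linear_combination hunique

theorem tendsto_baileyTransform (hq : ‖q‖ < 1) {f : ℕ → ℂ} (hf : Summable f) :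
    Tendsto (baileyTransform q f) atTop (𝓝 ((qPochInf q q)⁻¹ * ∑' n, f n)) := by
  obtain ⟨C, hC⟩ := exists_norm_invQFac_le hq
  have hlim : Tendsto (fun L : ℕ => ∑' n : ℕ, invQFac q (L - n) * f n) atTop
      (𝓝 (∑' n, (qPochInf q q)⁻¹ * f n)) := by
    refine tendsto_tsum_of_dominated_convergence (hf.norm.mul_left C) (fun n => ?_)
      (Eventually.of_forall fun L n => ?_)
    · exact ((tendsto_invQFac hq).comp (tendsto_atTop_add_const_right _ (-n : ℤ)
        tendsto_natCast_atTop_atTop)).mul_const _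
    · rw [norm_mul]
      gcongr
      exact hC _
  rw [tsum_mul_left] at hlim
  refine hlim.congr fun L => ?_
  rw [baileyTransform_eq_sum_range, tsum_eq_sum fun n hn => ?_]
  · refine sum_congr rfl fun n hn => ?_
    rw [Nat.cast_sub (Nat.lt_succ_iff.1 (mem_range.1 hn))]
  · rw [mem_range] at hn
    rw [invQFac_of_neg q (by omega), zero_mul]

end limits

theorem norm_pow_lt_one {s : ℂ} (hs : ‖s‖ < 1) {m : ℕ} (hm : m ≠ 0) : ‖s ^ m‖ < 1 := by
  rw [norm_pow]
  exact pow_lt_one₀ (norm_nonneg s) hs hm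

theorem tendsto_chain {s : ℂ} (hs : ‖s‖ < 1) (hs0 : s ≠ 0) {k i : ℕ} (hi : 1 ≤ i)
    (hik : i ≤ k + 2) :
    Tendsto (chain s k i) atTop (𝓝 (qPochInf (-s) (s ^ 2) *
      (qPochInf (s ^ (2 * k + 3 - i)) (s ^ (2 * k + 3)) * qPochInf (s ^ i) (s ^ (2 * k + 3)) *
        qPochInf (s ^ (2 * k + 3)) (s ^ (2 * k + 3)) *
      ((qPochInf (s ^ 2) (s ^ 2))⁻¹ * (qPochInf (s ^ 2) (s ^ 2))⁻¹)))) := by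
  have hs2 := norm_pow_lt_one hs two_ne_zero
  have hxy : -s ^ (2 * k + 3 - i) * -s ^ i = s ^ (2 * k + 3) := by
    rw [neg_mul_neg, ← pow_add, Nat.sub_add_cancel (by omega)]
  have hx0 : -s ^ (2 * k + 3 - i) ≠ 0 := neg_ne_zero.2 (pow_ne_zero _ hs0)
  have hy0 : -s ^ i ≠ 0 := neg_ne_zero.2 (pow_ne_zero _ hs0)
  have hxy1 : ‖-s ^ (2 * k + 3 - i) * -s ^ i‖ < 1 := hxy ▸ norm_pow_lt_one hs (by omega)
  have htriple := tsum_thetaTerm hx0 hy0 hxy1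
  rw [hxy, neg_neg, neg_neg] at htriple
  rw [← htriple]
  refine ((tendsto_qPoch (-s) hs2).mul (tendsto_thetaSum hs2 hx0 hy0 hxy1)).congr fun n => ?_
  rw [chain_eq_thetaSum (not_isOfFinOrder_of_norm_lt_one hs) hs0 k hi hik]

/-! ### The multiple series -/

theorem sum_Icc_one_eq_sum_range (f : ℕ → ℕ) (k : ℕ) :
    ∑ l ∈ Icc 1 k, f l = ∑ l ∈ range k, f (l + 1) := by
  rw [range_eq_Ico, sum_Ico_add' f 0 k 1]
  rfl

theorem tailSum_one {k : ℕ} (n : Fin k → ℕ) : tailSum n 1 = ∑ j, n j := by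
  simp [tailSum]

theorem tailSum_cons {k : ℕ} (a : ℕ) (n : Fin k → ℕ) (l : ℕ) :
    tailSum (Fin.cons a n : Fin (k + 1) → ℕ) (l + 2) = tailSum n (l + 1) := by
  simp [tailSum, sum_filter, Fin.sum_univ_succ]

theorem sqSum_cons {k : ℕ} (a : ℕ) (n : Fin k → ℕ) :
    sqSum (Fin.cons a n : Fin (k + 1) → ℕ) = (a + ∑ j, n j) ^ 2 + sqSum n := by
  rw [sqSum, sqSum, sum_Icc_one_eq_sum_range, sum_Icc_one_eq_sum_range, sum_range_succ', add_comm]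
  simp only [zero_add, tailSum_one, tailSum_cons, Fin.sum_cons, add_assoc, Nat.reduceAdd]

theorem sum_le_sqSum {k : ℕ} (n : Fin k → ℕ) : ∑ j, n j ≤ sqSum n := by
  cases k with
  | zero => simp
  | succ k =>
    rw [← Fin.cons_self_tail n, sqSum_cons, Fin.sum_cons]
    exact (Nat.le_self_pow two_ne_zero _).trans (Nat.le_add_right _ _)

theorem altSum_eq_sum_range {k i : ℕ} (hi : 1 ≤ i) (n : Fin k → ℕ) :
    altSum i n = ∑ l ∈ range k,
      if i ≤ l + 1 ∧ (l + 1) % 2 = i % 2 then tailSum n (l + 1) else 0 := by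
  rw [← sum_Icc_one_eq_sum_range fun l => if i ≤ l ∧ l % 2 = i % 2 then tailSum n l else 0,
    ← sum_filter, altSum]
  refine sum_congr ?_ fun _ _ => rfl
  ext l
  simp only [mem_filter, mem_Icc]
  omega

theorem altSum_one_cons {k : ℕ} (a : ℕ) (n : Fin k → ℕ) :
    altSum 1 (Fin.cons a n : Fin (k + 1) → ℕ) = (a + ∑ j, n j) + altSum 2 n := by
  rw [altSum_eq_sum_range le_rfl, altSum_eq_sum_range one_le_two, sum_range_succ', add_comm]
  congr 1
  · simp [tailSum_one, Fin.sum_cons]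
  · refine sum_congr rfl fun l _ => ?_
    rw [add_assoc l 1 1, tailSum_cons]
    exact if_congr (by omega) rfl rfl

theorem altSum_succ_cons {k i : ℕ} (hi : 1 ≤ i) (a : ℕ) (n : Fin k → ℕ) :
    altSum (i + 1) (Fin.cons a n : Fin (k + 1) → ℕ) = altSum i n := by
  rw [altSum_eq_sum_range (by omega), altSum_eq_sum_range hi, sum_range_succ',
    if_neg (by omega), add_zero]
  refine sum_congr rfl fun l _ => ?_
  rw [add_assoc l 1 1, tailSum_cons]
  exact if_congr (by omega) rfl rfl

theorem denom_cons {k : ℕ} (q : ℂ) (a : ℕ) (n : Fin (k + 1) → ℕ) :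
    denom q (Fin.cons a n : Fin (k + 2) → ℕ) = qPoch q q a * denom q n := by
  simp [denom, Fin.prod_univ_succ (n := k + 1)]

theorem pow_sqSum_altSum_cons {k i : ℕ} (hi : 1 ≤ i) (s : ℂ) (a : ℕ) (n : Fin k → ℕ) :
    s ^ (sqSum (Fin.cons a n : Fin (k + 1) → ℕ) +
        2 * altSum i (Fin.cons a n : Fin (k + 1) → ℕ)) =
      weight s i (a + ∑ j, n j) * s ^ (sqSum n + 2 * altSum (nextIndex i) n) := by
  rw [weight, ← pow_add, sqSum_cons]
  congr 1
  rcases hi.eq_or_lt with rfl | h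
  · rw [altSum_one_cons, if_pos rfl, nextIndex, if_pos rfl]
    ring
  · obtain ⟨j, rfl⟩ : ∃ j, i = j + 1 := ⟨i - 1, by omega⟩
    rw [altSum_succ_cons (by omega), if_neg (by omega), nextIndex, if_neg (by omega),
      Nat.add_sub_cancel]
    ring

/-- The general term of the multiple series, with `q = s ^ 2`. -/
noncomputable def seriesTerm {k : ℕ} (s : ℂ) (i : ℕ) (n : Fin k → ℕ) : ℂ :=
  s ^ (sqSum n + 2 * altSum i n) / denom (s ^ 2) n

theorem seriesTerm_cons {k i : ℕ} (hi : 1 ≤ i) (s : ℂ) (a : ℕ) (n : Fin (k + 1) → ℕ) :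
    seriesTerm s i (Fin.cons a n : Fin (k + 2) → ℕ) =
      weight s i (a + ∑ j, n j) * (invQFac (s ^ 2) a * seriesTerm s (nextIndex i) n) := by
  rw [seriesTerm, pow_sqSum_altSum_cons hi, denom_cons, seriesTerm, invQFac_natCast]
  field_simp

theorem seriesTerm_singleton {i : ℕ} (hi : 1 ≤ i) (s : ℂ) (N : ℕ) :
    seriesTerm s i ![N] = weight s i N * (qPoch (s ^ 4) (s ^ 4) N)⁻¹ := by
  have hpow : s ^ (sqSum ![N] + 2 * altSum i ![N]) = weight s i N := by
    simpa [sqSum, altSum, tailSum] using pow_sqSum_altSum_cons hi s N ![]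
  have hdenom : denom (s ^ 2) ![N] = qPoch (s ^ 4) (s ^ 4) N := by
    simp [denom, ← pow_mul]
  rw [seriesTerm, hpow, hdenom, div_eq_mul_inv]

theorem sum_antidiagonalTuple_succ {M : Type*} [AddCommMonoid M] (k N : ℕ)
    (f : (Fin (k + 1) → ℕ) → M) :
    ∑ n ∈ Finset.Nat.antidiagonalTuple (k + 1) N, f n =
      ∑ p ∈ antidiagonal N, ∑ n ∈ Finset.Nat.antidiagonalTuple k p.2, f (Fin.cons p.1 n) := by
  change ((List.Nat.antidiagonalTuple (k + 1) N).map f).sum =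
    ((List.Nat.antidiagonal N).map fun p =>
      ((List.Nat.antidiagonalTuple k p.2).map fun n => f (Fin.cons p.1 n)).sum).sum
  simp only [List.Nat.antidiagonalTuple, List.flatMap, List.map_flatten, List.sum_flatten,
    List.map_map, Function.comp_def]

theorem sum_antidiagonalTuple_seriesTerm (s : ℂ) (k : ℕ) {i : ℕ} (hi : 1 ≤ i) (N : ℕ) :
    ∑ n ∈ Finset.Nat.antidiagonalTuple (k + 1) N, seriesTerm s i n =
      weight s i N * chain s k (nextIndex i) N := by
  induction k generalizing i N with
  | zero =>
    rw [Finset.Nat.antidiagonalTuple_one, sum_singleton, seriesTerm_singleton hi, chain]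
  | succ k ih =>
    have hi' : 1 ≤ nextIndex i := by
      rw [nextIndex]
      split_ifs <;> omega
    rw [sum_antidiagonalTuple_succ, chain, baileyTransform, mul_sum]
    refine sum_congr rfl fun p hp => ?_
    rw [← ih hi' p.2, mul_sum, mul_sum]
    refine sum_congr rfl fun n hn => ?_
    rw [seriesTerm_cons hi, Finset.Nat.mem_antidiagonalTuple.1 hn,
      HasAntidiagonal.mem_antidiagonal.1 hp]

theorem summable_prod_fin {g : ℕ → ℝ} (hg : Summable g) (h0 : ∀ n, 0 ≤ g n) (k : ℕ) :
    Summable fun n : Fin k → ℕ => ∏ j, g (n j) := by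
  induction k with
  | zero => exact Summable.of_finite
  | succ k ih =>
    rw [← (Fin.consEquiv fun _ : Fin (k + 1) => ℕ).summable_iff]
    refine (hg.mul_of_nonneg ih h0 fun n => prod_nonneg fun j _ => h0 _).congr fun x => ?_
    simp [Fin.consEquiv, Fin.prod_univ_succ]

theorem exists_norm_inv_denom_le {q : ℂ} (hq : ‖q‖ < 1) (k : ℕ) :
    ∃ C : ℝ, ∀ n : Fin k → ℕ, ‖(denom q n)⁻¹‖ ≤ C := by
  obtain ⟨C₁, hC₁⟩ := exists_norm_invQFac_le hq
  obtain ⟨C₂, hC₂⟩ := exists_norm_invQFac_le (norm_pow_lt_one hq two_ne_zero)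
  refine ⟨∏ _j : Fin k, max C₁ C₂, fun n => ?_⟩
  rw [denom, ← prod_inv_distrib, norm_prod]
  refine prod_le_prod (fun _ _ => norm_nonneg _) fun j _ => ?_
  split_ifs
  · exact (hC₂ (n j)).trans (le_max_right _ _)
  · exact (hC₁ (n j)).trans (le_max_left _ _)

theorem summable_seriesTerm {s : ℂ} (hs : ‖s‖ < 1) (k i : ℕ) :
    Summable fun n : Fin k → ℕ => seriesTerm s i n := by
  obtain ⟨C, hC⟩ := exists_norm_inv_denom_le (norm_pow_lt_one hs two_ne_zero) k
  have hgeom := summable_prod_fin (summable_geometric_of_lt_one (norm_nonneg s) hs)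
    (fun n => by positivity) k
  refine (hgeom.mul_right C).of_norm_bounded fun n => ?_
  rw [seriesTerm, div_eq_mul_inv, norm_mul, norm_pow, prod_pow_eq_pow_sum]
  gcongr ?_ * ?_
  · exact pow_le_pow_of_le_one (norm_nonneg s) hs.le
      ((sum_le_sqSum n).trans (Nat.le_add_right _ _))
  · exact hC n

theorem hasSum_weight_mul_chain {s : ℂ} (hs : ‖s‖ < 1) (k : ℕ) {i : ℕ} (hi : 1 ≤ i) :
    HasSum (fun N => weight s i N * chain s k (nextIndex i) N)
      (∑' n : Fin (k + 1) → ℕ, seriesTerm s i n) := by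
  refine ((Finset.Nat.sigmaAntidiagonalTupleEquivTuple (k + 1)).hasSum_iff.2
    (summable_seriesTerm hs (k + 1) i).hasSum).sigma fun N => ?_
  rw [← sum_antidiagonalTuple_seriesTerm s k hi N]
  exact Finset.hasSum _ _

theorem tendsto_chain_succ {s : ℂ} (hs : ‖s‖ < 1) (k : ℕ) {i : ℕ} (hi : 1 ≤ i) :
    Tendsto (chain s (k + 1) i) atTop (𝓝 ((qPochInf (s ^ 2) (s ^ 2))⁻¹ *
      ∑' n : Fin (k + 1) → ℕ, seriesTerm s i n)) := by
  have hsum := hasSum_weight_mul_chain hs k hi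
  rw [← hsum.tsum_eq]
  exact tendsto_baileyTransform (norm_pow_lt_one hs two_ne_zero) hsum.summable

theorem tsum_seriesTerm {s : ℂ} (hs : ‖s‖ < 1) (hs0 : s ≠ 0) {k i : ℕ} (hi : 1 ≤ i)
    (hik : i ≤ k + 3) :
    ∑' n : Fin (k + 1) → ℕ, seriesTerm s i n =
      qPochInf (-s) (s ^ 2) *
        (qPochInf (s ^ i) (s ^ (2 * (k + 1) + 3)) *
          qPochInf (s ^ (2 * (k + 1) + 3 - i)) (s ^ (2 * (k + 1) + 3)) *
          qPochInf (s ^ (2 * (k + 1) + 3)) (s ^ (2 * (k + 1) + 3))) /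
        qPochInf (s ^ 2) (s ^ 2) := by
  have hunique := tendsto_nhds_unique (tendsto_chain_succ hs k hi) (tendsto_chain hs hs0 hi hik)
  have hne := qPochInf_self_ne_zero (norm_pow_lt_one hs two_ne_zero)
  field_simp at hunique ⊢
  linear_combination hunique

theorem hasSum_seriesTerm_zero (k i : ℕ) : HasSum (fun n : Fin k → ℕ => seriesTerm 0 i n) 1 := by
  have hzero : seriesTerm 0 i (0 : Fin k → ℕ) = 1 := by
    simp [seriesTerm, sqSum, altSum, tailSum, denom, qPoch_zero]
  rw [← hzero]
  refine hasSum_single 0 fun n hn => ?_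
  have hsq : sqSum n ≠ 0 := fun h => hn <| funext fun j =>
    Nat.eq_zero_of_le_zero <|
      (single_le_sum (fun _ _ => Nat.zero_le _) (mem_univ j)).trans (h ▸ sum_le_sqSum n)
  rw [seriesTerm, zero_pow (by omega), zero_div]

end Warnaar

theorem mainTheorem3_general (k i : ℕ) (hk : 1 ≤ k) (hi : 1 ≤ i) (hik : i ≤ k + 1)
    (q s : ℂ) (hq : ‖q‖ < 1) (hs : s ^ 2 = q) :
    HasSum
      (fun n : Fin k → ℕ =>
        s ^ (Warnaar.sqSum n + 2 * Warnaar.altSum i n) / Warnaar.denom q n)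
      (Warnaar.qPochInf (-s) q *
        (Warnaar.qPochInf (s ^ i) (s ^ (2 * k + 3)) *
          Warnaar.qPochInf (s ^ (2 * k - i + 3)) (s ^ (2 * k + 3)) *
          Warnaar.qPochInf (s ^ (2 * k + 3)) (s ^ (2 * k + 3))) /
        Warnaar.qPochInf q q) := by
  subst hs
  obtain ⟨k, rfl⟩ := Nat.exists_eq_add_of_le' hk
  rcases eq_or_ne s 0 with rfl | hs0
  · simpa [Warnaar.seriesTerm, Warnaar.qPochInf_zero, show i ≠ 0 by omega]
      using Warnaar.hasSum_seriesTerm_zero (k + 1) i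
  · have hs : ‖s‖ < 1 := by simpa using hq
    rw [show 2 * (k + 1) - i + 3 = 2 * (k + 1) + 3 - i by omega,
      ← Warnaar.tsum_seriesTerm hs hs0 hi (by omega)]
    exact (Warnaar.summable_seriesTerm hs (k + 1) i).hasSum

/-- Here `s` is the chosen square root `q^{1/2}` of `q`, and `q^{m/2}` is `s ^ m`. -/
theorem mainTheorem3 (k i : ℕ) (hk : 2 ≤ k) (hi : 1 ≤ i) (hik : i ≤ k)
    (q s : ℂ) (hq : ‖q‖ < 1) (hs : s ^ 2 = q) :
    HasSum
      (fun n : Fin k → ℕ =>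
        s ^ (Warnaar.sqSum n + 2 * Warnaar.altSum i n) / Warnaar.denom q n)
      (Warnaar.qPochInf (-s) q *
        (Warnaar.qPochInf (s ^ i) (s ^ (2 * k + 3)) *
          Warnaar.qPochInf (s ^ (2 * k - i + 3)) (s ^ (2 * k + 3)) *
          Warnaar.qPochInf (s ^ (2 * k + 3)) (s ^ (2 * k + 3))) /
        Warnaar.qPochInf q q) :=
  mainTheorem3_general k i (by omega) hi (by omega) q s hq hs
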